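/- Let $k$ be an algebraically closed field of characteristic $0$ and let $X\subset\mathbb A^n_k$ be a smooth irreducible affine variety of dimension $s$ whose vanishing ideal is the prime ideal $I_X=\langle g_1,\dots,g_m\rangle$. Put $A=k[x_1,\dots,x_n]/I_X$ and $\mathcal V=\mathrm{Der}_k(A)$. An $A\mathcal V$-module is a vector space $M$ over $k$ which is a module over the algebra $A$ and over the Lie algebra $\mathcal V$ such that $\eta(fm)=\eta(f)m+f(\eta m)$ for all $\eta\in\mathcal V$, $f\in A$, $m\in M$; it is simple if it is nonzero and has no $A\mathcal V$-submodules other than $0$ and itself. Let $J=(\partial g_i/\partial x_j)$ be the Jacobian matrix, with entries in $A$, and let $r$ be its rank over the fraction field of $A$. The standard atlas consists of the charts $N(h)=\{p\in X: h(p)\neq0\}$, one for each choice of $r$ rows and $r$ columns of $J$ whose minor $h$ is nonzero. The standard chart parameters $t_1,\dots,t_s$ in such a chart are the variables $x_j$ for which the $j$-th column of $J$ is not part of the minor; each $\partial/\partial t_i$ extends uniquely to a derivation of the localization $A_{(h)}=A[h^{-1}]$, and every $\eta\in\mathcal V$ is uniquely $\eta=\sum_i f_i\,\partial/\partial t_i$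 with $f_i\in A_{(h)}$. Let $U$ be a finite-dimensional $\mathfrak{gl}_s(k)$-module. Gauge fields in the chart are $A_{(h)}$-linear maps $B_1,\dots,B_s:A_{(h)}\otimes_k U\to A_{(h)}\otimes_k U$ that commute with the action of $\mathfrak{gl}_s(k)$ on the second factor and satisfy $[\partial/\partial t_i+B_i,\ \partial/\partial t_j+B_j]=0$ for all $i,j$. They make $A_{(h)}\otimes_k U$ an $A\mathcal V$-module in which $$\Big(f\frac{\partial}{\partial t_i}\Big)(g\otimes u)=f\frac{\partial g}{\partial t_i}\otimes u+gf\,B_i(1\otimes u)+\sum_{q=1}^s g\frac{\partial f}{\partial t_q}\otimes E_{qi}u ,$$ where $E_{qi}\in\mathfrak{gl}_s(k)$ are the matrix units. A local gauge module is an $A\mathcal V$-submodule of such a module that is finitely generated over $A$. An $A\mathcal V$-module is a gauge module associated with $U$ if, for every chart of the standard atlas, it is isomorphic to a local gauge module in $A_{(h)}\otimes_k U$ for some choice of gauge fields in that chart. **Theorem.** If $U$ is simple, then every nonzero gauge module associated with $U$ is a simple $A\mathcal V$-module. -/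

import Mathlib

open scoped TensorProduct

attribute [local instance 100] LieRing.ofAssociativeRing

noncomputable section

namespace GaugeMod

variable {k : Type*} [Field k] {n m : ℕ}

/-! ## The coordinate ring, the Jacobian matrix and the standard atlas -/

/-- The algebra `A` of polynomial functions on the variety in affine `n`-space cut out by
`g 0, …, g (m - 1)`; it is used when these polynomials generate a prime ideal, which is then the
full ideal of functions vanishing on the variety if `k` is algebraically closed. -/
def CoordRing (g : Fin m → MvPolynomial (Fin n) k) : Type _ :=
  MvPolynomial (Fin n) k ⧸ Ideal.span (Set.range g)

instance (g : Fin m → MvPolynomial (Fin n) k) : CommRing (CoordRing g) :=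
  inferInstanceAs (CommRing (MvPolynomial (Fin n) k ⧸ Ideal.span (Set.range g)))

instance (g : Fin m → MvPolynomial (Fin n) k) : Algebra k (CoordRing g) :=
  inferInstanceAs (Algebra k (MvPolynomial (Fin n) k ⧸ Ideal.span (Set.range g)))

instance (g : Fin m → MvPolynomial (Fin n) k) [(Ideal.span (Set.range g)).IsPrime] :
    IsDomain (CoordRing g) :=
  inferInstanceAs (IsDomain (MvPolynomial (Fin n) k ⧸ Ideal.span (Set.range g)))

/-- The function on the variety given by a polynomial. -/
def toCoordRing (g : Fin m → MvPolynomial (Fin n) k) :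
    MvPolynomial (Fin n) k →ₐ[k] CoordRing g :=
  Ideal.Quotient.mkₐ k (Ideal.span (Set.range g))

theorem toCoordRing_surjective (g : Fin m → MvPolynomial (Fin n) k) :
    Function.Surjective (toCoordRing g) :=
  Ideal.Quotient.mkₐ_surjective k _

theorem toCoordRing_eq_zero {g : Fin m → MvPolynomial (Fin n) k} {p : MvPolynomial (Fin n) k} :
    toCoordRing g p = 0 ↔ p ∈ Ideal.span (Set.range g) :=
  Ideal.Quotient.eq_zero_iff_mem

/-- The `j`-th coordinate function `x_j` on the variety. -/
def coord (g : Fin m → MvPolynomial (Fin n) k) (j : Fin n) : CoordRing g :=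
  toCoordRing g (MvPolynomial.X j)

/-- The Jacobian matrix `J = (∂ g_i / ∂ x_j)`, with entries in `A`. -/
def jacobian (g : Fin m → MvPolynomial (Fin n) k) : Matrix (Fin m) (Fin n) (CoordRing g) :=
  Matrix.of fun i j => toCoordRing g (MvPolynomial.pderiv j (g i))

/-- The rank `r` of the Jacobian matrix over the fraction field of `A`. -/
def jacobianRank (g : Fin m → MvPolynomial (Fin n) k) : ℕ :=
  ((jacobian g).map (algebraMap (CoordRing g) (FractionRing (CoordRing g)))).rank

/-- A chart of the standard atlas: a choice of `r` rows and `r` columns for which the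
corresponding `r × r` minor of the Jacobian matrix is a nonzero element of `A`. -/
structure StandardChart (g : Fin m → MvPolynomial (Fin n) k) where
  /-- the rows of the minor -/
  rows : Fin (jacobianRank g) ↪o Fin m
  /-- the columns of the minor -/
  cols : Fin (jacobianRank g) ↪o Fin n
  minor_ne_zero : ((jacobian g).submatrix rows cols).det ≠ 0

namespace StandardChart

variable {g : Fin m → MvPolynomial (Fin n) k} (C : StandardChart g)

/-- The minor `h` that defines the chart `N(h)`. -/
def minor : CoordRing g := ((jacobian g).submatrix C.rows C.cols).det

/-- The localized algebra `A_(h)`. -/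
abbrev LocRing : Type _ := Localization.Away C.minor

/-- An enumeration `t_1, …, t_s` of the standard chart parameters, that is, of the coordinate
functions `x_j` for which the `j`-th column of the Jacobian is not part of the minor. -/
abbrev Params (s : ℕ) : Type := Fin s ≃ {j : Fin n // j ∉ Set.range C.cols}

variable {C} {s : ℕ}

/-- The chart parameter `t_i`, as an element of `A`. -/
def param (t : C.Params s) (i : Fin s) : CoordRing g := coord g (t i)

/-- The coordinates of affine space are those in the minor together with the chart parameters. -/
def splitIndex (t : C.Params s) : Fin (jacobianRank g) ⊕ Fin s ≃ Fin n :=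
  ((Equiv.ofInjective C.cols C.cols.injective).sumCongr t).trans
    (Equiv.Set.sumCompl (Set.range C.cols))

theorem splitIndex_inl (t : C.Params s) (a : Fin (jacobianRank g)) :
    splitIndex t (Sum.inl a) = C.cols a := rfl

theorem splitIndex_inr (t : C.Params s) (i : Fin s) : splitIndex t (Sum.inr i) = t i := rfl

/-- A vector killed by the rows of the Jacobian that occur in the minor is killed by all rows. -/
theorem jacobian_row_eq_zero [(Ideal.span (Set.range g)).IsPrime]
    (C : StandardChart g) (v : Fin n → C.LocRing)
    (hv : ∀ a, ∑ j, algebraMap (CoordRing g) C.LocRing (jacobian g (C.rows a) j) * v j = 0)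
    (i : Fin m) : ∑ j, algebraMap (CoordRing g) C.LocRing (jacobian g i j) * v j = 0 := by
  set F := FractionRing (CoordRing g) with hF
  have hne : C.minor ≠ 0 := C.minor_ne_zero
  have hle : Submonoid.powers C.minor ≤ nonZeroDivisors (CoordRing g) :=
    powers_le_nonZeroDivisors_of_noZeroDivisors hne
  have hunit : ∀ y : Submonoid.powers C.minor, IsUnit (algebraMap (CoordRing g) F y) :=
    fun y => IsLocalization.map_units F ⟨y.1, hle y.2⟩
  let φ : C.LocRing →+* F := IsLocalization.lift hunit
  have hφA : ∀ a, φ (algebraMap (CoordRing g) C.LocRing a) = algebraMap (CoordRing g) F a :=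
    fun a => IsLocalization.lift_eq hunit a
  have hφ : Function.Injective φ := by
    refine (IsLocalization.lift_injective_iff hunit).2 fun x y => ?_
    rw [(IsLocalization.injective C.LocRing hle).eq_iff,
      (IsFractionRing.injective (CoordRing g) F).eq_iff]
  set JF : Matrix (Fin m) (Fin n) F := (jacobian g).map (algebraMap (CoordRing g) F) with hJF
  have hrank : JF.rank = jacobianRank g := rfl
  have hli : LinearIndependent F fun a => JF (C.rows a) := by
    have h1 : IsUnit (JF.submatrix C.rows C.cols) := by
      rw [Matrix.isUnit_iff_isUnit_det, isUnit_iff_ne_zero, hJF, Matrix.submatrix_map,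
        ← RingHom.mapMatrix_apply, ← RingHom.map_det]
      exact fun h => hne ((IsFractionRing.injective (CoordRing g) F) (h.trans (map_zero _).symm))
    exact LinearIndependent.of_comp (LinearMap.funLeft F F C.cols)
      (Matrix.linearIndependent_rows_iff_isUnit.2 h1)
  have hspan : Submodule.span F (Set.range fun a => JF (C.rows a)) =
      Submodule.span F (Set.range JF.row) := by
    refine Submodule.eq_of_le_of_finrank_eq (Submodule.span_mono ?_) ?_
    · rintro _ ⟨a, rfl⟩
      exact ⟨C.rows a, rfl⟩
    · rw [← Matrix.rank_eq_finrank_span_row, hrank, finrank_span_eq_card hli, Fintype.card_fin]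
  have hker : Submodule.span F (Set.range fun a => JF (C.rows a)) ≤
      LinearMap.ker (Fintype.linearCombination F fun j => φ (v j)) := by
    rw [Submodule.span_le]
    rintro _ ⟨a, rfl⟩
    have := congrArg φ (hv a)
    simpa [Fintype.linearCombination_apply, hJF, hφA] using this
  have hmem : JF i ∈ LinearMap.ker (Fintype.linearCombination F fun j => φ (v j)) :=
    hker (hspan ▸ Submodule.subset_span ⟨i, rfl⟩)
  apply hφ
  simpa [Fintype.linearCombination_apply, hJF, hφA] using hmem

/-- The chain rule for a derivation of the coordinate ring. -/
theorem derivation_toCoordRing {N : Type*} [AddCommGroup N] [Module k N] [Module (CoordRing g) N]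
    (d : Derivation k (CoordRing g) N) (p : MvPolynomial (Fin n) k) :
    d (toCoordRing g p) = ∑ j, toCoordRing g (MvPolynomial.pderiv j p) • d (coord g j) := by
  induction p using MvPolynomial.induction_on with
  | C a =>
    have : toCoordRing g (MvPolynomial.C a) = algebraMap k (CoordRing g) a :=
      (toCoordRing g).commutes a
    simp [this]
  | add p q hp hq => simp [hp, hq, add_smul, Finset.sum_add_distrib]
  | mul_X p i hp =>
    have hX : toCoordRing g (MvPolynomial.X i) = coord g i := rfl
    rw [map_mul, Derivation.leibniz, hp, hX]
    simp only [Derivation.leibniz, MvPolynomial.pderiv_X, smul_eq_mul, map_add, map_mul, add_smul,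
      Finset.sum_add_distrib, hX, Finset.smul_sum, mul_smul]
    congr 1
    rw [Finset.sum_eq_single i]
    · simp
    · intro b _ hb
      simp [Ne.symm hb]
    · simp

/-- A derivation from `A` to `A_(h)` that kills the chart parameters is zero. -/
theorem derivation_eq_zero (t : C.Params s) (d : Derivation k (CoordRing g) C.LocRing)
    (hd : ∀ i, d (param t i) = 0) : d = 0 := by
  have hu : IsUnit (algebraMap (CoordRing g) C.LocRing C.minor) :=
    IsLocalization.Away.algebraMap_isUnit C.minor
  have hcols : ∀ a, d (coord g (C.cols a)) = 0 := by
    have hm : (((jacobian g).submatrix C.rows C.cols).map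
        (algebraMap (CoordRing g) C.LocRing)).mulVec (fun a => d (coord g (C.cols a))) = 0 := by
      funext b
      have h0 : toCoordRing g (g (C.rows b)) = 0 :=
        toCoordRing_eq_zero.2 (Ideal.subset_span ⟨_, rfl⟩)
      have h1 := derivation_toCoordRing d (g (C.rows b))
      rw [h0, map_zero, ← (splitIndex t).sum_comp, Fintype.sum_sum_type] at h1
      have h2 : ∀ i, d (coord g (t i)) = 0 := hd
      simp only [splitIndex_inl, splitIndex_inr, h2, smul_zero, Finset.sum_const_zero,
        add_zero] at h1
      rw [Pi.zero_apply, h1, Matrix.mulVec, dotProduct]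
      exact Finset.sum_congr rfl fun a _ =>
        (Algebra.smul_def (jacobian g (C.rows b) (C.cols a)) (d (coord g (C.cols a)))).symm
    have hM : IsUnit (((jacobian g).submatrix C.rows C.cols).map
        (algebraMap (CoordRing g) C.LocRing)) := by
      rw [Matrix.isUnit_iff_isUnit_det, ← RingHom.mapMatrix_apply, ← RingHom.map_det]
      exact hu
    have := (Matrix.mulVec_injective_of_isUnit hM) (hm.trans (Matrix.mulVec_zero _).symm)
    exact fun a => congrFun this a
  ext x
  obtain ⟨p, rfl⟩ := toCoordRing_surjective g x
  have := derivation_toCoordRing d p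
  rw [← (splitIndex t).sum_comp, Fintype.sum_sum_type] at this
  have h2 : ∀ i, d (coord g (t i)) = 0 := hd
  simpa [splitIndex_inl, splitIndex_inr, hcols, h2] using this

/-- The composite of a derivation of `A_(h)` with `A → A_(h)`. -/
def restrictDer (C : StandardChart g) (d : Derivation k C.LocRing C.LocRing) :
    Derivation k (CoordRing g) C.LocRing :=
  d.compAlgebraMap (CoordRing g)

/-- Derivations from `A` to `A_(h)` extend uniquely to `A_(h)`. -/
theorem restrictDer_bijective (C : StandardChart g) : Function.Bijective (restrictDer C) := by
  set M := Submonoid.powers C.minor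
  have hunits : ∀ x : M,
      IsUnit ((algebraMap (CoordRing g) (Module.End (CoordRing g) C.LocRing)) x) := fun x => by
    have h := (IsLocalization.map_units C.LocRing x).map
      (Algebra.lmul (CoordRing g) C.LocRing)
    convert! h using 1
    ext y
    simp [Algebra.smul_def]
  constructor
  · intro d₁ d₂ h
    have h' : ∀ a, d₁ (algebraMap (CoordRing g) C.LocRing a) =
        d₂ (algebraMap (CoordRing g) C.LocRing a) := fun a => congrArg (fun d => d a) h
    ext x
    obtain ⟨⟨a, b⟩, hab⟩ := IsLocalization.surj M x
    have hb := IsLocalization.map_units C.LocRing b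
    have e₁ := congrArg d₁ hab
    have e₂ := congrArg d₂ hab
    rw [Derivation.leibniz] at e₁ e₂
    rw [h' a, h' b.1, ← e₂, add_left_cancel_iff, smul_eq_mul, smul_eq_mul] at e₁
    exact hb.mul_left_cancel e₁
  · intro d
    let l := IsLocalizedModule.lift M (KaehlerDifferential.map k k (CoordRing g) C.LocRing)
      d.liftKaehlerDifferential hunits
    let l' : Ω[C.LocRing⁄k] →ₗ[C.LocRing] C.LocRing :=
      LinearMap.extendScalarsOfIsLocalization M C.LocRing l
    refine ⟨l'.compDer (KaehlerDifferential.D k C.LocRing), ?_⟩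
    ext a
    have h := IsLocalizedModule.lift_apply M
      (KaehlerDifferential.map k k (CoordRing g) C.LocRing)
      d.liftKaehlerDifferential hunits (KaehlerDifferential.D k _ a)
    rw [KaehlerDifferential.map_D, Derivation.liftKaehlerDifferential_comp_D] at h
    exact h

/-- Every solution of the Jacobian system is the vector of values of a derivation. -/
theorem exists_derivation (C : StandardChart g) (v : Fin n → C.LocRing)
    (hv : ∀ i, ∑ j, algebraMap (CoordRing g) C.LocRing (jacobian g i j) * v j = 0) :
    ∃ d : Derivation k (CoordRing g) C.LocRing, ∀ j, d (coord g j) = v j := by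
  let _ : Module (MvPolynomial (Fin n) k) C.LocRing :=
    Module.compHom C.LocRing (toCoordRing g).toRingHom
  have hsmul : ∀ (p : MvPolynomial (Fin n) k) (x : C.LocRing), p • x = toCoordRing g p • x :=
    fun _ _ => rfl
  have : IsScalarTower k (MvPolynomial (Fin n) k) C.LocRing :=
    ⟨fun a p x => by rw [hsmul, hsmul, map_smul, smul_assoc]⟩
  let D : Derivation k (MvPolynomial (Fin n) k) C.LocRing := MvPolynomial.mkDerivation k v
  have hD : ∀ p, D p = ∑ j, toCoordRing g (MvPolynomial.pderiv j p) • v j := by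
    intro p
    have hs : ∀ (E : Fin n → Derivation k (MvPolynomial (Fin n) k) C.LocRing)
        (q : MvPolynomial (Fin n) k), (∑ j, E j) q = ∑ j, E j q := fun E q => by
      have h := congrFun (map_sum Derivation.coeFnAddMonoidHom E Finset.univ) q
      rw [Finset.sum_apply] at h
      exact h
    have h : D = ∑ j, (LinearMap.toSpanSingleton _ C.LocRing (v j)).compDer
        (MvPolynomial.pderiv (R := k) j) := by
      refine MvPolynomial.derivation_ext fun i => ?_
      rw [MvPolynomial.mkDerivation_X, hs, Finset.sum_eq_single i]
      · simp
      · intro b _ hb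
        simp [MvPolynomial.pderiv_X_of_ne hb.symm]
      · simp
    rw [h, hs]
    rfl
  have hker : ∀ p, toCoordRing g p = 0 → D p = 0 := by
    intro p hp
    rw [toCoordRing_eq_zero] at hp
    induction hp using Submodule.span_induction with
    | mem x hx =>
      obtain ⟨i, rfl⟩ := hx
      rw [hD, ← hv i]
      exact Finset.sum_congr rfl fun j _ => Algebra.smul_def _ _
    | zero => exact map_zero D
    | add x y _ _ hx hy => rw [map_add, hx, hy, add_zero]
    | smul a x hx h =>
      have hx0 : toCoordRing g x = 0 := toCoordRing_eq_zero.2 hx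
      rw [smul_eq_mul, Derivation.leibniz, h, smul_zero, zero_add, hsmul, hx0, zero_smul]
  let L : CoordRing g →ₗ[k] C.LocRing :=
    ((Ideal.span (Set.range g)).restrictScalars k).liftQ D.toLinearMap
      (fun p hp => hker p (toCoordRing_eq_zero.2 hp))
  have hL : ∀ p, L (toCoordRing g p) = D p := fun p => rfl
  refine ⟨Derivation.mk' L ?_, fun j => ?_⟩
  · intro a b
    obtain ⟨p, rfl⟩ := toCoordRing_surjective g a
    obtain ⟨q, rfl⟩ := toCoordRing_surjective g b
    rw [← map_mul, hL, hL, hL, Derivation.leibniz, hsmul, hsmul]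
  · exact (hL _).trans (MvPolynomial.mkDerivation_X k v j)

/-- The derivation `∂ / ∂ t_i` of `k[t_1, …, t_s]` extends uniquely to `A_(h)`. -/
theorem existsUnique_partialDeriv [(Ideal.span (Set.range g)).IsPrime] (t : C.Params s)
    (i : Fin s) : ∃! d : Derivation k C.LocRing C.LocRing,
      ∀ j, d (algebraMap (CoordRing g) C.LocRing (param t j)) = if j = i then 1 else 0 := by
  set ι := algebraMap (CoordRing g) C.LocRing
  set M := ((jacobian g).submatrix C.rows C.cols).map ι with hM
  have hMdet : IsUnit M.det := by
    rw [hM, ← RingHom.mapMatrix_apply, ← RingHom.map_det]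
    exact IsLocalization.Away.algebraMap_isUnit C.minor
  let u : Fin (jacobianRank g) → C.LocRing :=
    -(M⁻¹.mulVec fun a => ι (jacobian g (C.rows a) (t i)))
  let v : Fin n → C.LocRing := fun j => Sum.elim u (Pi.single i 1) ((splitIndex t).symm j)
  have hv1 : ∀ a, v (C.cols a) = u a := fun a => by
    simp [v, ← splitIndex_inl t]
  have hv2 : ∀ j, v (t j) = if j = i then 1 else 0 := fun j => by
    simp [v, ← splitIndex_inr t, Pi.single_apply]
  obtain ⟨d, hd⟩ := exists_derivation C v (jacobian_row_eq_zero C v fun a => by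
    rw [← (splitIndex t).sum_comp, Fintype.sum_sum_type]
    simp only [splitIndex_inl, splitIndex_inr, hv1, hv2, mul_ite, mul_one, mul_zero,
      Finset.sum_ite_eq', Finset.mem_univ, if_true]
    have : M.mulVec u = -fun a => ι (jacobian g (C.rows a) (t i)) := by
      rw [Matrix.mulVec_neg, Matrix.mulVec_mulVec, Matrix.mul_nonsing_inv _ hMdet,
        Matrix.one_mulVec]
    have h := congrFun this a
    rw [Pi.neg_apply] at h
    exact add_eq_zero_iff_eq_neg.2 h)
  obtain ⟨e, he⟩ := (restrictDer_bijective C).2 d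
  have hval : ∀ a, e (ι a) = d a := fun a => congrArg (fun d => d a) he
  refine ⟨e, fun j => (hval _).trans ((hd _).trans (hv2 j)), fun e' h' => ?_⟩
  apply (restrictDer_bijective C).1
  rw [← sub_eq_zero]
  refine derivation_eq_zero t _ fun j => ?_
  rw [Derivation.sub_apply, sub_eq_zero]
  exact (h' j).trans ((hval _).trans ((hd _).trans (hv2 j))).symm

/-- The derivation `∂ / ∂ t_i` of `A_(h)`. -/
def partialDeriv [(Ideal.span (Set.range g)).IsPrime] (t : C.Params s) (i : Fin s) :
    Derivation k C.LocRing C.LocRing :=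
  (existsUnique_partialDeriv t i).choose

theorem partialDeriv_param [(Ideal.span (Set.range g)).IsPrime] (t : C.Params s) (i j : Fin s) :
    partialDeriv t i (algebraMap (CoordRing g) C.LocRing (param t j)) = if j = i then 1 else 0 :=
  (existsUnique_partialDeriv t i).choose_spec.1 j

/-- The `i`-th coefficient `f_i ∈ A_(h)` of a vector field `η = ∑ i, f_i ∂ / ∂ t_i`. -/
def coeff (t : C.Params s) (η : Derivation k (CoordRing g) (CoordRing g)) (i : Fin s) :
    C.LocRing :=
  algebraMap (CoordRing g) C.LocRing (η (param t i))

/-- The coefficients do represent the vector field: `η = ∑ i, f_i ∂ / ∂ t_i`. -/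
theorem algebraMap_apply_eq_sum [(Ideal.span (Set.range g)).IsPrime] (t : C.Params s)
    (η : Derivation k (CoordRing g) (CoordRing g)) (a : CoordRing g) :
    algebraMap (CoordRing g) C.LocRing (η a) =
      ∑ i, coeff t η i * partialDeriv t i (algebraMap (CoordRing g) C.LocRing a) := by
  have hs : ∀ (E : Fin s → Derivation k (CoordRing g) C.LocRing) (a : CoordRing g),
      (∑ j, E j) a = ∑ j, E j a := fun E a => by
    have h := congrFun (map_sum Derivation.coeFnAddMonoidHom E Finset.univ) a
    rw [Finset.sum_apply] at h
    exact h
  have h := derivation_eq_zero t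
    ((Algebra.linearMap (CoordRing g) C.LocRing).compDer η -
      ∑ i, restrictDer C (coeff t η i • partialDeriv t i)) fun j => by
    rw [Derivation.sub_apply, hs, sub_eq_zero]
    change coeff t η j = ∑ i, coeff t η i *
      partialDeriv t i (algebraMap (CoordRing g) C.LocRing (param t j))
    simp [partialDeriv_param]
  have h' := congrArg (fun d => d a) h
  simp only [Derivation.sub_apply, hs, Derivation.zero_apply, sub_eq_zero] at h'
  exact h'

end StandardChart

/-! ## Modules over functions and vector fields -/

section AVModule

variable (k) (A : Type*) [CommRing A] [Algebra k A] (M : Type*) [AddCommGroup M] [Module k M]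
  [Module A M] [LieRingModule (Derivation k A A) M]

/-- An `A𝒱`-module, where `𝒱 = Der A`: a space with an action of the algebra `A` and an action of
the Lie algebra `𝒱` such that `η (f m) = η(f) m + f (η m)`. -/
class IsAVModule : Prop extends IsScalarTower k A M, LieModule k (Derivation k A A) M where
  lie_smul_eq (η : Derivation k A A) (f : A) (x : M) : ⁅η, f • x⁆ = η f • x + f • ⁅η, x⁆

/-- An `A𝒱`-module is simple if it is nonzero and its only submodules are `0` and itself. -/
def IsSimpleAVModule : Prop :=
  Nontrivial M ∧ ∀ N : Submodule A M,
    (∀ (η : Derivation k A A), ∀ x ∈ N, ⁅η, x⁆ ∈ N) → N = ⊥ ∨ N = ⊤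

end AVModule

/-! ## Gauge modules -/

section Gauge

variable {g : Fin m → MvPolynomial (Fin n) k} [(Ideal.span (Set.range g)).IsPrime]
  {C : StandardChart g} {s : ℕ}
  (U : Type*) [AddCommGroup U] [Module k U] [LieRingModule (Matrix (Fin s) (Fin s) k) U]
  [LieModule k (Matrix (Fin s) (Fin s) k) U]

/-- The operator `g ⊗ u ↦ g ⊗ x u` on `A_(h) ⊗ U` given by an element `x` of `gl_s`. -/
def glOp (C : StandardChart g) (x : Matrix (Fin s) (Fin s) k) :
    Module.End k (C.LocRing ⊗[k] U) :=
  (LieModule.toEnd k (Matrix (Fin s) (Fin s) k) U x).lTensor C.LocRing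

/-- The operator `g ⊗ u ↦ ∂g / ∂t_i ⊗ u` on `A_(h) ⊗ U`. -/
def derivOp (t : C.Params s) (i : Fin s) : Module.End k (C.LocRing ⊗[k] U) :=
  (StandardChart.partialDeriv t i : C.LocRing →ₗ[k] C.LocRing).rTensor U

/-- Gauge fields `B_1, …, B_s` on `A_(h) ⊗ U`, for a `gl_s`-module `U`. -/
structure GaugeFields (t : C.Params s) where
  /-- the `A_(h)`-linear operators `B_i` -/
  B : Fin s → Module.End C.LocRing (C.LocRing ⊗[k] U)
  /-- the `B_i` commute with the action of `gl_s` -/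
  lie_gl (i : Fin s) (x : Matrix (Fin s) (Fin s) k) :
    ⁅(B i).restrictScalars k, glOp U C x⁆ = 0
  /-- the operators `∂ / ∂t_i + B_i` commute with each other -/
  lie_nabla (i j : Fin s) :
    ⁅derivOp U t i + (B i).restrictScalars k, derivOp U t j + (B j).restrictScalars k⁆ = 0

variable {U} {t : C.Params s}

/-- The action on `A_(h) ⊗ U` of a vector field `η = ∑ i, f_i ∂ / ∂t_i` on the variety: the field
`f ∂ / ∂t_i` sends `g ⊗ u` to
`f ∂g/∂t_i ⊗ u + g f B_i (1 ⊗ u) + ∑ q, g ∂f/∂t_q ⊗ E_{q i} u`. -/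
def GaugeFields.action (B : GaugeFields U t) (η : Derivation k (CoordRing g) (CoordRing g)) :
    Module.End k (C.LocRing ⊗[k] U) :=
  ∑ i, (StandardChart.coeff t η i • (derivOp U t i + (B.B i).restrictScalars k) +
    ∑ q, StandardChart.partialDeriv t q (StandardChart.coeff t η i) •
      glOp U C (Matrix.single q i (1 : k)))

variable (U)

/-- `M` is isomorphic, as an `A𝒱`-module, to a local gauge module in the given chart: to an
`A`-finitely generated `A𝒱`-submodule of `A_(h) ⊗ U` for some choice of gauge fields. -/
def IsLocalGauge (t : C.Params s) (M : Type*) [AddCommGroup M] [Module (CoordRing g) M]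
    [LieRingModule (Derivation k (CoordRing g) (CoordRing g)) M] : Prop :=
  ∃ (B : GaugeFields U t) (N : Submodule (CoordRing g) (C.LocRing ⊗[k] U))
    (_ : ∀ η, ∀ x ∈ N, B.action η x ∈ N) (e : M ≃ₗ[CoordRing g] N),
    N.FG ∧ ∀ η x, ((e ⁅η, x⁆ : N) : C.LocRing ⊗[k] U) = B.action η (e x)

/-- `M` is a gauge module associated with `U`: in every chart of the standard atlas, for some
enumeration `t_1, …, t_s` of the standard chart parameters, it is isomorphic to a local gauge
module. -/
def IsGaugeModule (s : ℕ) (g : Fin m → MvPolynomial (Fin n) k) [(Ideal.span (Set.range g)).IsPrime]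
    (U : Type*) [AddCommGroup U] [Module k U] [LieRingModule (Matrix (Fin s) (Fin s) k) U]
    [LieModule k (Matrix (Fin s) (Fin s) k) U]
    (M : Type*) [AddCommGroup M] [Module (CoordRing g) M]
    [LieRingModule (Derivation k (CoordRing g) (CoordRing g)) M] : Prop :=
  ∀ C : StandardChart g, ∃ t : C.Params s, IsLocalGauge U t M

end Gauge

end GaugeMod

end

/-! A single chart suffices. It embeds `M` in `A_(h) ⊗ U`, and a nonzero `A𝒱`-submodule `N` of `M`
turns out to span `A_(h) ⊗ U` over `A_(h)`. Hence every element of `M / N` is killed by a power of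
`h`. As `M` is finitely generated over `A`, one nonzero element of `A` annihilates all of `M / N`.
The annihilator of `M / N` is an ideal stable under `𝒱`, so it is `A` by differential simplicity
(`eq_top_of_derivation_stable`), and `N = M`.

Differential simplicity of a smooth domain: at a `k`-point with maximal ideal `𝔪`, projectivity of
the Kähler differentials gives a vector field `E = ∑ c_l D_l` with `c_l ∈ 𝔪` acting as the identity
on `𝔪 / 𝔪 ^ 2`, hence as `j` on `𝔪 ^ j / 𝔪 ^ (j + 1)`. If a stable ideal `I` lies in `𝔪 ^ j`, then
`E` maps it into `𝔪 ^ (j + 1)`, so in characteristic zero `I ⊆ 𝔪 ^ (j + 1)`. By Krull's intersection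
theorem `I = 0`.

Spanning (`span_eq_top_of_action_stable`): comparing the vector field `t_p η` with `t_p` times the
action of `η` isolates the matrix units, so the span `W` is stable under `gl_s` and then under each
`∂ / ∂t_j + B_j`. By Burnside's theorem `W` is stable under all of `End U`, so `a ⊗ U ⊆ W` for some
`a ≠ 0`; by Schur's lemma each `B_j` is multiplication by a function, so the ideal of such `a` is
stable under the `∂ / ∂t_j`. Differential simplicity passes from `A` to `A_(h)` and makes this ideal
the unit ideal. -/

noncomputable section

namespace GaugeMod

/-! ## Differential simplicity of smooth algebras -/

section DifferentialSimplicity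

variable {k A : Type*} [Field k] [CommRing A] [Algebra k A]

/-- A point `ε` of an affine scheme defines the derivation `a ↦ [a - ε(a)]` with values in the
cotangent space at that point. -/
def cotangentDerivation (ε : A →ₐ[k] k) :
    Derivation k A (RingHom.ker ε).Cotangent :=
  Derivation.mk'
    { toFun := fun a => (RingHom.ker ε).toCotangent ⟨a - algebraMap k A (ε a), by simp⟩
      map_add' := fun a b => by
        rw [← map_add]
        congr 1
        ext
        simp only [map_add, Submodule.coe_add]
        ring
      map_smul' := fun c a => by
        rw [RingHom.id_apply, ← LinearMap.map_smul_of_tower]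
        congr 1
        ext
        simp [Algebra.smul_def, mul_sub] }
    (fun a b => by
      change (RingHom.ker ε).toCotangent _ = a • (RingHom.ker ε).toCotangent _ +
        b • (RingHom.ker ε).toCotangent _
      rw [← map_smul, ← map_smul, ← map_add, Ideal.toCotangent_eq]
      -- The defect in the Leibniz rule is exactly minus this product.
      have h : (a - algebraMap k A (ε a)) * (b - algebraMap k A (ε b)) ∈ RingHom.ker ε ^ 2 := by
        rw [pow_two]
        exact Ideal.mul_mem_mul (by simp) (by simp)
      rw [← neg_mem_iff]
      convert! h using 1
      simp only [map_mul, Submodule.coe_add, Submodule.coe_smul, smul_eq_mul]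
      ring)

theorem cotangentDerivation_apply (ε : A →ₐ[k] k) (a : A) :
    cotangentDerivation ε a =
      (RingHom.ker ε).toCotangent ⟨a - algebraMap k A (ε a), by simp⟩ := rfl

/-- If the Kähler differentials are finite projective, each point has an Euler vector field: it is
an `𝔪`-linear combination of vector fields and acts as the identity on `𝔪 / 𝔪 ^ 2`. -/
theorem exists_euler_derivation [Module.Finite A (Ω[A⁄k])] [Module.Projective A (Ω[A⁄k])]
    (ε : A →ₐ[k] k) :
    ∃ (N : ℕ) (c : Fin N → A) (D : Fin N → Derivation k A A),
      (∀ l, c l ∈ RingHom.ker ε) ∧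
      ∀ a ∈ RingHom.ker ε, ∑ l, c l * D l a - a ∈ RingHom.ker ε ^ 2 := by
  classical
  -- A dual basis: `D_l` is the `l`-th coordinate of `p ∘ d`, and `c_l` lifts the class in `𝔪 / 𝔪 ^
  -- 2` of the image of the `l`-th generator of the differentials. Applying `φ` to `da = f (p (da))`
  -- gives the claim.
  obtain ⟨N, f, p, -, -, hfp⟩ := Module.Finite.exists_comp_eq_id_of_projective A (Ω[A⁄k])
  let φ := (cotangentDerivation ε).liftKaehlerDifferential
  choose c hc using fun l : Fin N =>
    (RingHom.ker ε).toCotangent_surjective (φ (f (Pi.single l 1)))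
  refine ⟨N, fun l => c l,
    fun l => ((LinearMap.proj l).comp p).compDer (KaehlerDifferential.D k A),
    fun l => (c l).2, fun a ha => ?_⟩
  have h1 : φ (KaehlerDifferential.D k A a) = (RingHom.ker ε).toCotangent ⟨a, ha⟩ := by
    rw [Derivation.liftKaehlerDifferential_comp_D, cotangentDerivation_apply]
    congr 2
    rw [RingHom.mem_ker.1 ha, map_zero, sub_zero]
  have h2 : f (p (KaehlerDifferential.D k A a)) = KaehlerDifferential.D k A a :=
    LinearMap.congr_fun hfp _
  rw [← h2, ← Finset.univ_sum_single (p (KaehlerDifferential.D k A a)), map_sum, map_sum] at h1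
  have h3 : ∀ l, φ (f (Pi.single l (p (KaehlerDifferential.D k A a) l))) =
      (RingHom.ker ε).toCotangent (p (KaehlerDifferential.D k A a) l • c l) := fun l => by
    rw [map_smul, hc, ← map_smul, ← map_smul, ← Pi.single_smul, smul_eq_mul, mul_one]
  simp only [h3] at h1
  rw [← map_sum, Ideal.toCotangent_eq] at h1
  convert! h1 using 2
  rw [AddSubmonoidClass.coe_finsetSum]
  exact Finset.sum_congr rfl fun l _ => mul_comm _ _

/-- A derivation that is the identity on `I / I ^ 2` is multiplication by `j` on
`I ^ j / I ^ (j + 1)` for every `j > 0`. -/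
theorem derivation_sub_mem_pow {I : Ideal A} (E : Derivation k A A)
    (hE : ∀ a ∈ I, E a - a ∈ I ^ 2) (j : ℕ) :
    ∀ a ∈ I ^ (j + 1), E a - (j + 1 : A) * a ∈ I ^ (j + 2) := by
  induction j with
  | zero => simpa using hE
  | succ j ih =>
    intro a ha
    rw [pow_succ'] at ha
    induction ha using Submodule.mul_induction_on' with
    | mem_mul_mem x hx y hy =>
      have h : E (x * y) - ((j + 1 : ℕ) + 1 : A) * (x * y) =
          x * (E y - (j + 1 : A) * y) + (E x - x) * y := by
        rw [Derivation.leibniz]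
        push_cast
        simp only [smul_eq_mul]
        ring
      rw [h]
      refine add_mem ?_ ?_
      · rw [show j + 1 + 2 = (j + 2) + 1 by ring, pow_succ']
        exact Ideal.mul_mem_mul hx (ih y hy)
      · rw [show j + 1 + 2 = 2 + (j + 1) by ring, pow_add]
        exact Ideal.mul_mem_mul (hE x hx) hy
    | add x _ y _ hx hy =>
      have := add_mem hx hy
      rw [map_add]
      convert! this using 1
      ring

/-- A maximal ideal of an algebra of finite type over an algebraically closed field is the kernel
of a `k`-point. -/
theorem exists_ker_eq_of_isMaximal [IsAlgClosed k] [Algebra.FiniteType k A] (P : Ideal A)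
    [P.IsMaximal] : ∃ ε : A →ₐ[k] k, RingHom.ker ε = P := by
  let _ : Field (A ⧸ P) := Ideal.Quotient.field P
  -- Nullstellensatz: the residue field is finite over `k`, hence equal to it.
  have : Module.Finite k (A ⧸ P) := finite_of_finite_type_of_isJacobsonRing k (A ⧸ P)
  let e : k ≃ₐ[k] A ⧸ P := AlgEquiv.ofBijective (Algebra.ofId k (A ⧸ P))
    (IsAlgClosed.algebraMap_bijective_of_isIntegral (k := k))
  refine ⟨e.symm.toAlgHom.comp (Ideal.Quotient.mkₐ k P), ?_⟩
  ext a
  rw [RingHom.mem_ker, AlgHom.comp_apply, ← Ideal.Quotient.eq_zero_iff_mem]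
  exact map_eq_zero_iff e.symm e.symm.injective

/-- A smooth domain over an algebraically closed field of characteristic zero has no nonzero proper
ideals that are stable under all derivations. -/
theorem eq_top_of_derivation_stable [IsAlgClosed k] [CharZero k] [IsDomain A] [Algebra.Smooth k A]
    {I : Ideal A} (hI : I ≠ ⊥) (hstable : ∀ (η : Derivation k A A), ∀ a ∈ I, η a ∈ I) : I = ⊤ := by
  by_contra htop
  have : IsNoetherianRing A := Algebra.FiniteType.isNoetherianRing k A
  obtain ⟨P, hP, hIP⟩ := Ideal.exists_le_maximal I htop
  obtain ⟨ε, rfl⟩ := exists_ker_eq_of_isMaximal (k := k) P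
  obtain ⟨N, c, D, hc, hD⟩ := exists_euler_derivation ε
  have hsum : ∀ a, (∑ l, c l • D l) a = ∑ l, c l * D l a := fun a => by
    have h := congrFun (map_sum Derivation.coeFnAddMonoidHom (fun l => c l • D l) Finset.univ) a
    rw [Finset.sum_apply] at h
    exact h
  -- For `a ∈ I` inside `𝔪 ^ (j + 1)`, stability puts each `D_l a` in `𝔪 ^ (j + 1)` and the factor
  -- `c_l ∈ 𝔪` gains one more power. Modulo `𝔪 ^ (j + 2)` the same sum equals `(j + 1) a`.
  have key : ∀ j : ℕ, I ≤ RingHom.ker ε ^ (j + 1) := by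
    intro j
    induction j with
    | zero => simpa using hIP
    | succ j ih =>
      intro a ha
      have h1 := derivation_sub_mem_pow (∑ l, c l • D l)
        (fun a ha => by rw [hsum]; exact hD a ha) j a (ih ha)
      have h2 : (∑ l, c l • D l) a ∈ RingHom.ker ε ^ (j + 2) := by
        rw [hsum, show j + 2 = (j + 1) + 1 from rfl, pow_succ']
        exact sum_mem fun l _ => Ideal.mul_mem_mul (hc l) (ih (hstable (D l) a ha))
      have h3 := (Submodule.sub_mem_iff_right _ h2).1 h1
      have hu : IsUnit (j + 1 : A) := by
        have : (j + 1 : A) = algebraMap k A (j + 1 : k) := by simp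
        rw [this]
        exact (IsUnit.mk0 _ (Nat.cast_add_one_ne_zero j)).map _
      exact (Ideal.unit_mul_mem_iff_mem _ hu).1 h3
  refine hI (le_bot_iff.1 ?_)
  -- Krull's intersection theorem in a Noetherian domain.
  rw [← Ideal.iInf_pow_eq_bot_of_isDomain _ hP.ne_top]
  exact le_iInf fun j => (key j).trans (Ideal.pow_le_pow_right (Nat.le_succ j))

end DifferentialSimplicity

/-! ## Irreducible modules -/

section Density

variable {k : Type*} [Field k] [IsAlgClosed k] {L U : Type*} [LieRing L] [LieAlgebra k L]
  [AddCommGroup U] [Module k U] [FiniteDimensional k U] [LieRingModule L U] [LieModule k L U]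
  [LieModule.IsIrreducible k L U]

/-- Burnside's theorem: a finite-dimensional irreducible module over an algebraically closed field
generates the full algebra of endomorphisms. -/
theorem adjoin_range_toEnd_eq_top :
    Algebra.adjoin k (Set.range (LieModule.toEnd k L U)) = ⊤ := by
  set S := Algebra.adjoin k (Set.range (LieModule.toEnd k L U))
  have hmem : ∀ x : L, LieModule.toEnd k L U x ∈ S := fun x => Algebra.subset_adjoin ⟨x, rfl⟩
  have : Nontrivial U := LieModule.nontrivial_of_isIrreducible k L U
  have hsimple : IsSimpleModule S U := by
    refine { exists_pair_ne := ⟨⊥, ⊤, bot_ne_top⟩, eq_bot_or_eq_top := fun N => ?_ }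
    let N' : LieSubmodule k L U :=
      { N.restrictScalars k with
        lie_mem := fun {x u} hu => N.smul_mem ⟨_, hmem x⟩ hu }
    have h : ∀ u, u ∈ N' ↔ u ∈ N := fun u => Iff.rfl
    rcases eq_bot_or_eq_top N' with h' | h'
    · left
      ext u
      rw [← h, h', LieSubmodule.mem_bot, Submodule.mem_bot]
    · right
      ext u
      rw [← h, h']
      simp
  -- Schur's lemma: an eigenspace of `f` is a nonzero submodule over `S`.
  have hscalar : ∀ f : Module.End S U, ∃ c : k, ∀ u, f u = c • u := by
    intro f
    obtain ⟨c, hc⟩ := Module.End.exists_eigenvalue (f.restrictScalars k : Module.End k U)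
    obtain ⟨v, hv, hv0⟩ := hc.exists_hasEigenvector
    rw [Module.End.mem_eigenspace_iff] at hv
    let N : Submodule S U := LinearMap.ker (f - c • LinearMap.id)
    have hN : N ≠ ⊥ := (Submodule.ne_bot_iff _).2 ⟨v, by simpa [N, sub_eq_zero] using hv, hv0⟩
    have hN' : N = ⊤ := (eq_bot_or_eq_top N).resolve_left hN
    refine ⟨c, fun u => ?_⟩
    have hu : u ∈ N := hN' ▸ Submodule.mem_top
    simpa [N, sub_eq_zero] using hu
  rw [eq_top_iff]
  intro T _
  -- The commutant of `S` is scalar, so any `T` lies in the bicommutant. Density then matches `T`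
  -- with an element of `S` on a finite spanning set of `U`.
  let F : Module.End (Module.End S U) U :=
    { T with
      map_smul' := fun f u => by
        obtain ⟨c, hc⟩ := hscalar f
        change T (f u) = f (T u)
        rw [hc, hc, map_smul] }
  obtain ⟨s, hs⟩ := Module.Finite.fg_top (R := k) (M := U)
  obtain ⟨r, hr⟩ := jacobson_density (R := S) F s
  have : T = r.1 := LinearMap.ext_on hs fun u hu => hr u hu
  rw [this]
  exact r.2

end Density

/-! ## Submodules of `R ⊗ U` for an irreducible module `U` -/

section TensorIrreducible

variable {k : Type*} [Field k] {L U : Type*} [LieRing L] [LieAlgebra k L]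
  [AddCommGroup U] [Module k U] [LieRingModule L U] [LieModule k L U]
  {R : Type*} [CommRing R] [Algebra k R]

variable (R) in
/-- The map `a ⊗ u ↦ φ(u) a`. -/
def tensorEval (φ : U →ₗ[k] k) : R ⊗[k] U →ₗ[k] R :=
  (TensorProduct.rid k R).toLinearMap ∘ₗ φ.lTensor R

theorem tensorEval_tmul (φ : U →ₗ[k] k) (a : R) (u : U) : tensorEval R φ (a ⊗ₜ u) = φ u • a := by
  simp [tensorEval]

/-- Rank-one endomorphisms of `U` extract coefficients: this is how stability under `End U` gives
information about ideals of `R`. -/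
theorem tensorEval_tmul_eq (φ : U →ₗ[k] k) (x : R ⊗[k] U) (w : U) :
    tensorEval R φ x ⊗ₜ[k] w = (φ.smulRight w).lTensor R x := by
  induction x with
  | zero => simp
  | tmul a u => simp [tensorEval_tmul, TensorProduct.smul_tmul]
  | add x y hx hy => rw [map_add, map_add, TensorProduct.add_tmul, hx, hy]

/-- The ideal of coefficients `a` with `a ⊗ U ⊆ W`. -/
def coeffIdeal (W : Submodule R (R ⊗[k] U)) : Ideal R where
  carrier := {a | ∀ u : U, a ⊗ₜ[k] u ∈ W}
  add_mem' ha hb u := by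
    rw [TensorProduct.add_tmul]
    exact add_mem (ha u) (hb u)
  zero_mem' u := by
    rw [TensorProduct.zero_tmul]
    exact zero_mem W
  smul_mem' c a ha u := by
    rw [← TensorProduct.smul_tmul']
    exact W.smul_mem c (ha u)

theorem mem_coeffIdeal {W : Submodule R (R ⊗[k] U)} {a : R} :
    a ∈ coeffIdeal W ↔ ∀ u : U, a ⊗ₜ[k] u ∈ W := Iff.rfl

theorem eq_top_of_coeffIdeal_eq_top {W : Submodule R (R ⊗[k] U)} (h : coeffIdeal W = ⊤) :
    W = ⊤ := by
  rw [eq_top_iff]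
  intro x _
  induction x with
  | zero => exact zero_mem W
  | tmul a u => exact mem_coeffIdeal.1 (h ▸ Submodule.mem_top : a ∈ coeffIdeal W) u
  | add x y hx hy => exact add_mem (hx trivial) (hy trivial)

variable [IsAlgClosed k] [FiniteDimensional k U] [LieModule.IsIrreducible k L U]

variable (L) in
/-- A subspace of `R ⊗ U` that is stable under `L` is stable under all endomorphisms of `U`. -/
theorem lTensor_mem {W : Submodule R (R ⊗[k] U)}
    (hW : ∀ x : L, ∀ w ∈ W, (LieModule.toEnd k L U x).lTensor R w ∈ W) (T : Module.End k U)
    {w : R ⊗[k] U} (hw : w ∈ W) : T.lTensor R w ∈ W := by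
  have hT : T ∈ Algebra.adjoin k (Set.range (LieModule.toEnd k L U)) := by
    rw [adjoin_range_toEnd_eq_top]
    exact Algebra.mem_top
  induction hT using Algebra.adjoin_induction generalizing w with
  | mem T hT =>
    obtain ⟨x, rfl⟩ := hT
    exact hW x w hw
  | algebraMap c =>
    rw [Algebra.algebraMap_eq_smul_one, LinearMap.lTensor_smul, LinearMap.smul_apply,
      Module.End.one_eq_id, LinearMap.lTensor_id, LinearMap.id_apply]
    exact W.smul_of_tower_mem c hw
  | add S T _ _ hS hT =>
    rw [LinearMap.lTensor_add]
    exact add_mem (hS hw) (hT hw)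
  | mul S T _ _ hS hT =>
    rw [Module.End.mul_eq_comp, LinearMap.lTensor_comp]
    exact hS (hT hw)

-- Expand a nonzero element of `W` in a basis of `U`; some coefficient is nonzero, and rank-one
-- endomorphisms move it onto every vector of `U` without leaving `W`.
variable (L) in
theorem coeffIdeal_ne_bot {W : Submodule R (R ⊗[k] U)}
    (hW : ∀ x : L, ∀ w ∈ W, (LieModule.toEnd k L U x).lTensor R w ∈ W) (hne : W ≠ ⊥) :
    coeffIdeal W ≠ ⊥ := by
  obtain ⟨x, hx, hx0⟩ := (Submodule.ne_bot_iff _).1 hne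
  let b := Module.finBasis k U
  have hsum : x = ∑ i, tensorEval R (b.coord i) x ⊗ₜ[k] b i := by
    clear hx hx0
    induction x with
    | zero => simp
    | tmul a u =>
      simp only [tensorEval_tmul, TensorProduct.smul_tmul, ← TensorProduct.tmul_sum]
      congr 1
      exact (b.sum_repr u).symm
    | add x y hx hy =>
      nth_rw 1 [hx, hy]
      simp only [map_add, TensorProduct.add_tmul, Finset.sum_add_distrib]
  obtain ⟨i, hi⟩ : ∃ i, tensorEval R (b.coord i) x ≠ 0 := by
    by_contra! h
    exact hx0 (hsum.trans (by simp [h]))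
  refine (Submodule.ne_bot_iff _).2 ⟨_, fun w => ?_, hi⟩
  rw [tensorEval_tmul_eq]
  exact lTensor_mem L hW _ hx

variable (L) in
/-- Schur's lemma with coefficients. -/
theorem exists_eq_mul_tmul (B : Module.End R (R ⊗[k] U))
    (hB : ∀ (x : L) w, B ((LieModule.toEnd k L U x).lTensor R w) =
      (LieModule.toEnd k L U x).lTensor R (B w)) :
    ∃ b : R, ∀ a (u : U), B (a ⊗ₜ u) = b • a ⊗ₜ u := by
  have hcomm : ∀ (T : Module.End k U) w, B (T.lTensor R w) = T.lTensor R (B w) := by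
    intro T
    have hT : T ∈ Algebra.adjoin k (Set.range (LieModule.toEnd k L U)) := by
      rw [adjoin_range_toEnd_eq_top]
      exact Algebra.mem_top
    induction hT using Algebra.adjoin_induction with
    | mem T hT =>
      obtain ⟨x, rfl⟩ := hT
      exact hB x
    | algebraMap c =>
      intro w
      rw [Algebra.algebraMap_eq_smul_one, LinearMap.lTensor_smul, LinearMap.smul_apply,
        LinearMap.smul_apply, Module.End.one_eq_id, LinearMap.lTensor_id, LinearMap.id_apply,
        LinearMap.id_apply, LinearMap.map_smul_of_tower]
    | add S T _ _ hS hT =>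
      intro w
      simp only [LinearMap.lTensor_add, LinearMap.add_apply, map_add, hS, hT]
    | mul S T _ _ hS hT =>
      intro w
      simp only [Module.End.mul_eq_comp, LinearMap.lTensor_comp, LinearMap.comp_apply, hS, hT]
  have : Nontrivial U := LieModule.nontrivial_of_isIrreducible k L U
  obtain ⟨v, hv⟩ := exists_ne (0 : U)
  obtain ⟨φ, hφ⟩ := Module.Projective.exists_dual_eq_one k hv
  -- Since `φ v = 1`, the rank-one map `φ(·) u` sends `v` to `u`. As `B` commutes with it, `B (1 ⊗
  -- v)` determines `B`, and only its `φ`-coefficient matters.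
  refine ⟨tensorEval R φ (B (1 ⊗ₜ v)), fun a u => ?_⟩
  have h : a ⊗ₜ[k] u = a • (φ.smulRight u).lTensor R (1 ⊗ₜ v) := by
    simp [hφ, TensorProduct.smul_tmul']
  rw [h, map_smul, hcomm, ← tensorEval_tmul_eq, ← h, TensorProduct.smul_tmul',
    TensorProduct.smul_tmul', smul_eq_mul, smul_eq_mul, mul_comm]

variable (L) in
/-- An `L`-stable submodule of `R ⊗ U` that is also stable under connections `∂ + B`, where the
operators `B` commute with `L`, is everything as soon as `R` has no nonzero proper ideals that are
stable under the derivations `∂`. -/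
theorem eq_top_of_stable {ι : Type*} {d : ι → Derivation k R R}
    (hR : ∀ I : Ideal R, I ≠ ⊥ → (∀ i, ∀ a ∈ I, d i a ∈ I) → I = ⊤)
    {B : ι → Module.End R (R ⊗[k] U)}
    (hB : ∀ i (x : L) w, B i ((LieModule.toEnd k L U x).lTensor R w) =
      (LieModule.toEnd k L U x).lTensor R (B i w))
    {W : Submodule R (R ⊗[k] U)} (hne : W ≠ ⊥)
    (hL : ∀ x : L, ∀ w ∈ W, (LieModule.toEnd k L U x).lTensor R w ∈ W)
    (hd : ∀ i, ∀ w ∈ W, (d i : R →ₗ[k] R).rTensor U w + B i w ∈ W) : W = ⊤ := by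
  refine eq_top_of_coeffIdeal_eq_top (hR _ (coeffIdeal_ne_bot L hL hne) fun i a ha u => ?_)
  -- The operator `B i` is multiplication by `b`, so its contribution `b a ⊗ u` already lies in `W`
  -- and leaves `∂a ⊗ u ∈ W`.
  obtain ⟨b, hb⟩ := exists_eq_mul_tmul L (B i) (hB i)
  have h := hd i _ (ha u)
  rw [hb, LinearMap.rTensor_tmul] at h
  exact (Submodule.add_mem_iff_left _ (W.smul_mem b (ha u))).1 h

end TensorIrreducible

/-! ## Standard charts -/

/-- A maximal independent family of rows has as many members as the rank; listing their indices
increasingly gives the embedding. -/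
theorem exists_orderEmb_linearIndependent_rows {F : Type*} [Field F] {m n r : ℕ}
    (J : Matrix (Fin m) (Fin n) F) (hr : J.rank = r) :
    ∃ e : Fin r ↪o Fin m, LinearIndependent F fun i => J (e i) := by
  classical
  obtain ⟨κ, a, ha, hspan, hli⟩ := exists_linearIndependent' F J.row
  have : Fintype κ := Fintype.ofInjective a ha
  have hcard : (Finset.univ.image a).card = r := by
    rw [Finset.card_image_of_injective _ ha, Finset.card_univ, ← finrank_span_eq_card hli, hspan,
      ← Matrix.rank_eq_finrank_span_row, hr]
  have hset : LinearIndepOn F J.row (Set.range a) := (linearIndepOn_range_iff ha _).2 hli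
  let e := (Finset.univ.image a).orderEmbOfFin hcard
  have he : ∀ i, e i ∈ Set.range a := fun i => by
    obtain ⟨x, -, hx⟩ := Finset.mem_image.1
      (Finset.orderEmbOfFin_mem (Finset.univ.image a) hcard i)
    exact ⟨x, hx⟩
  exact ⟨e, hset.comp (fun i => ⟨e i, he i⟩) fun i j hij =>
    e.injective (show e i = e j from Subtype.mk.inj hij)⟩

variable {k : Type*} [Field k] {n m : ℕ}

/-- Row rank equals column rank: choose independent rows of the Jacobian over the fraction field,
then independent columns of the submatrix they form. -/
theorem nonempty_standardChart (g : Fin m → MvPolynomial (Fin n) k)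
    [(Ideal.span (Set.range g)).IsPrime] : Nonempty (StandardChart g) := by
  set F := FractionRing (CoordRing g)
  set JF : Matrix (Fin m) (Fin n) F := (jacobian g).map (algebraMap (CoordRing g) F) with hJF
  obtain ⟨rows, hrows⟩ := exists_orderEmb_linearIndependent_rows (r := jacobianRank g) JF rfl
  have hrank : (JF.submatrix rows id).transpose.rank = jacobianRank g := by
    rw [Matrix.rank_transpose]
    exact (LinearIndependent.rank_matrix (M := JF.submatrix rows id) hrows).trans
      (Fintype.card_fin _)
  obtain ⟨cols, hcols⟩ := exists_orderEmb_linearIndependent_rows _ hrank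
  refine ⟨⟨rows, cols, fun h => ?_⟩⟩
  have hu : IsUnit (JF.submatrix rows cols).transpose :=
    Matrix.linearIndependent_rows_iff_isUnit.1 hcols
  rw [Matrix.isUnit_transpose, Matrix.isUnit_iff_isUnit_det, isUnit_iff_ne_zero, hJF,
    Matrix.submatrix_map, ← RingHom.mapMatrix_apply, ← RingHom.map_det, h, map_zero] at hu
  exact hu rfl

namespace StandardChart

variable {g : Fin m → MvPolynomial (Fin n) k} [(Ideal.span (Set.range g)).IsPrime]
  {C : StandardChart g} {s : ℕ}

theorem powers_minor_le (C : StandardChart g) :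
    Submonoid.powers C.minor ≤ nonZeroDivisors (CoordRing g) :=
  powers_le_nonZeroDivisors_of_noZeroDivisors C.minor_ne_zero

theorem algebraMap_injective (C : StandardChart g) :
    Function.Injective (algebraMap (CoordRing g) C.LocRing) :=
  IsLocalization.injective C.LocRing C.powers_minor_le

/-- A derivation of `A_(h)` becomes a vector field on the variety after multiplication by a power
of `h`. -/
theorem exists_derivation_eq_mul (d : Derivation k C.LocRing C.LocRing) :
    ∃ (c : Submonoid.powers C.minor) (η : Derivation k (CoordRing g) (CoordRing g)),
      ∀ a, algebraMap (CoordRing g) C.LocRing (η a) =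
        algebraMap (CoordRing g) C.LocRing c * d (algebraMap (CoordRing g) C.LocRing a) := by
  set ι := algebraMap (CoordRing g) C.LocRing with hι
  -- By the chain rule it is enough to clear the denominators of the values at the finitely many
  -- coordinates.
  obtain ⟨c, hc⟩ := IsLocalization.exist_integer_multiples_of_finite (Submonoid.powers C.minor)
    fun j => d (ι (coord g j))
  have hex : ∀ a, ∃ b, ι b = ι c * d (ι a) := by
    intro a
    choose b hb using hc
    obtain ⟨p, rfl⟩ := toCoordRing_surjective g a
    refine ⟨∑ j, toCoordRing g (MvPolynomial.pderiv j p) * b j, ?_⟩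
    have h : d (ι (toCoordRing g p)) = _ := derivation_toCoordRing (restrictDer C d) p
    rw [h, map_sum, Finset.mul_sum]
    refine Finset.sum_congr rfl fun j _ => ?_
    rw [map_mul, hb, Algebra.smul_def, Algebra.smul_def]
    change ι _ * (ι c * d (ι (coord g j))) = ι c * (ι _ * d (ι (coord g j)))
    ring
  choose b hb using hex
  have hk : ∀ (r : k) x, ι (r • x) = r • ι x :=
    map_smul (IsScalarTower.toAlgHom k (CoordRing g) C.LocRing)
  have hinj := C.algebraMap_injective
  refine ⟨c, Derivation.mk'
    { toFun := b
      map_add' := fun x y => hinj (by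
        rw [map_add, ← hι, hb, hb, hb, map_add, map_add, mul_add])
      map_smul' := fun r x => hinj (by
        rw [RingHom.id_apply, ← hι, hk, hb, hb, hk, Derivation.map_smul, mul_smul_comm]) } (fun x y => hinj (by
        change ι (b (x * y)) = ι (x * b y + y * b x)
        rw [map_add, map_mul, map_mul, hb, hb, hb, map_mul, Derivation.leibniz]
        simp only [smul_eq_mul]
        ring)), hb⟩

/-- The algebra `A_(h)` of a chart of a smooth variety has no nonzero proper ideals that are stable
under all `∂ / ∂t_i`. -/
theorem eq_top_of_partialDeriv_stable [IsAlgClosed k] [CharZero k] [Algebra.Smooth k (CoordRing g)]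
    (t : C.Params s) (I : Ideal C.LocRing) (hI : I ≠ ⊥)
    (hd : ∀ i, ∀ a ∈ I, partialDeriv t i a ∈ I) : I = ⊤ := by
  -- The contraction to `A` is nonzero because it generates `I`, and stable because every vector
  -- field is an `A_(h)`-combination of the `∂ / ∂t_i`.
  have h : I.comap (algebraMap (CoordRing g) C.LocRing) = ⊤ := by
    refine eq_top_of_derivation_stable (k := k) (fun h => hI ?_) fun η a ha => ?_
    · rw [← IsLocalization.map_under (Submonoid.powers C.minor) C.LocRing I, Ideal.under, h,
        Ideal.map_bot]
    · rw [Ideal.mem_comap, algebraMap_apply_eq_sum t]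
      exact sum_mem fun i _ => I.mul_mem_left _ (hd i _ ha)
  exact Ideal.comap_eq_top_iff.1 h

end StandardChart

/-! ## Simplicity of gauge modules -/

section LocalGauge

open StandardChart

variable {k : Type*} [Field k] {n m s : ℕ} {g : Fin m → MvPolynomial (Fin n) k}
  {C : StandardChart g} {U : Type*} [AddCommGroup U] [Module k U]

theorem derivOp_smul [(Ideal.span (Set.range g)).IsPrime] (t : C.Params s) (i : Fin s) (r : C.LocRing) (w : C.LocRing ⊗[k] U) :
    derivOp U t i (r • w) = r • derivOp U t i w + partialDeriv t i r • w := by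
  induction w with
  | zero => simp
  | tmul a u =>
    simp only [derivOp, LinearMap.rTensor_tmul, TensorProduct.smul_tmul',
      Derivation.coeFn_coe, smul_eq_mul, Derivation.leibniz, ← TensorProduct.add_tmul, mul_comm a]
  | add x y hx hy =>
    simp only [smul_add, map_add, hx, hy]
    abel

variable [LieRingModule (Matrix (Fin s) (Fin s) k) U] [LieModule k (Matrix (Fin s) (Fin s) k) U]

theorem glOp_smul (x : Matrix (Fin s) (Fin s) k) (r : C.LocRing) (w : C.LocRing ⊗[k] U) :
    glOp U C x (r • w) = r • glOp U C x w := by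
  induction w with
  | zero => simp
  | tmul a u => simp only [glOp, LinearMap.lTensor_tmul, TensorProduct.smul_tmul']
  | add x y hx hy => simp only [smul_add, map_add, hx, hy]

variable [(Ideal.span (Set.range g)).IsPrime] {t : C.Params s}

theorem GaugeFields.action_apply (B : GaugeFields U t)
    (η : Derivation k (CoordRing g) (CoordRing g)) (w : C.LocRing ⊗[k] U) :
    B.action η w = ∑ i, (coeff t η i • (derivOp U t i w + B.B i w) +
      ∑ q, partialDeriv t q (coeff t η i) • glOp U C (Matrix.single q i (1 : k)) w) := by
  simp [GaugeFields.action, LinearMap.sum_apply]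

/-- The failure of the action of vector fields to be linear over the functions. -/
theorem GaugeFields.action_smul_sub (B : GaugeFields U t) (f : CoordRing g)
    (η : Derivation k (CoordRing g) (CoordRing g)) (w : C.LocRing ⊗[k] U) :
    B.action (f • η) w - f • B.action η w =
      ∑ i, ∑ q, (coeff t η i * partialDeriv t q (algebraMap _ C.LocRing f)) •
        glOp U C (Matrix.single q i (1 : k)) w := by
  have hc : ∀ i, coeff t (f • η) i = algebraMap _ C.LocRing f * coeff t η i := fun i => by
    simp [coeff]
  rw [B.action_apply, B.action_apply, ← algebraMap_smul C.LocRing f (∑ i, _), Finset.smul_sum,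
    ← Finset.sum_sub_distrib]
  -- Only `∂(f f_i) / ∂t_q = f ∂f_i / ∂t_q + f_i ∂f / ∂t_q` is not linear in `f`; its last term
  -- survives.
  refine Finset.sum_congr rfl fun i _ => ?_
  simp only [hc, Derivation.leibniz, smul_eq_mul, smul_add, Finset.smul_sum, smul_smul, add_smul,
    Finset.sum_add_distrib]
  abel

/-- A nonzero `A𝒱`-submodule of `A_(h) ⊗ U` spans it over `A_(h)`. -/
theorem span_eq_top_of_action_stable [IsAlgClosed k] [CharZero k] [FiniteDimensional k U]
    [LieModule.IsIrreducible k (Matrix (Fin s) (Fin s) k) U] [Algebra.Smooth k (CoordRing g)]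
    (B : GaugeFields U t) {N : Submodule (CoordRing g) (C.LocRing ⊗[k] U)} (hN : N ≠ ⊥)
    (hstable : ∀ η, ∀ x ∈ N, B.action η x ∈ N) :
    Submodule.span C.LocRing (N : Set (C.LocRing ⊗[k] U)) = ⊤ := by
  set W := Submodule.span C.LocRing (N : Set (C.LocRing ⊗[k] U))
  have hsub : ∀ x ∈ N, x ∈ W := fun x hx => Submodule.subset_span hx
  -- Each `η j` is `c_j ∂ / ∂t_j`, where `c_j` is a power of `h` and so a unit in `A_(h)`.
  choose c η hη using fun j => exists_derivation_eq_mul (partialDeriv t j)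
  have hcoeff : ∀ i j, coeff t (η j) i = if i = j then algebraMap _ C.LocRing (c j).1 else 0 := by
    intro i j
    rw [coeff, hη, partialDeriv_param, mul_ite, mul_one, mul_zero]
  have hunit : ∀ (j) (w : C.LocRing ⊗[k] U), algebraMap _ C.LocRing (c j).1 • w ∈ W → w ∈ W :=
    fun j w hw => (Submodule.smul_mem_iff_of_isUnit W (IsLocalization.map_units C.LocRing (c j))).1
      hw
  have hgl : ∀ x : Matrix (Fin s) (Fin s) k, ∀ w ∈ W, glOp U C x w ∈ W := by
    intro x
    induction x using Matrix.induction_on' with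
    | h_zero =>
      intro w _
      simp [glOp]
    | h_add x y hx hy =>
      intro w hw
      have : glOp U C (x + y) w = glOp U C x w + glOp U C y w := by
        simp [glOp, LinearMap.lTensor_add]
      rw [this]
      exact add_mem (hx w hw) (hy w hw)
    | h_std_basis p j a =>
      intro w hw
      induction hw using Submodule.span_induction with
      | mem w hw =>
        -- Because `∂t_p / ∂t_q` is a Kronecker delta, this difference is `c_j E_{pj} w`.
        have h := sub_mem (hstable (param t p • η j) w hw)
          (N.smul_mem (param t p) (hstable (η j) w hw))
        rw [B.action_smul_sub] at h
        simp only [hcoeff, partialDeriv_param, mul_ite, mul_one, mul_zero,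
          ite_smul, zero_smul, Finset.sum_ite_eq, Finset.sum_ite_eq', Finset.mem_univ,
          if_true] at h
        have h1 := hunit j _ (hsub _ h)
        have h2 : glOp U C (Matrix.single p j a) w = a • glOp U C (Matrix.single p j 1) w := by
          have h3 : Matrix.single p j a = a • Matrix.single p j (1 : k) := by simp
          rw [h3, glOp, glOp, map_smul, LinearMap.lTensor_smul, LinearMap.smul_apply]
        rw [h2]
        exact W.smul_of_tower_mem a h1
      | zero => simp
      | add x y _ _ hx hy =>
        rw [map_add]
        exact add_mem hx hy
      | smul r x _ hx =>
        rw [glOp_smul]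
        exact W.smul_mem r hx
  have hnabla : ∀ j, ∀ w ∈ W, derivOp U t j w + B.B j w ∈ W := by
    intro j w hw
    induction hw using Submodule.span_induction with
    | mem w hw =>
      -- The action of `η j` is `c_j (∂ / ∂t_j + B_j)` plus matrix-unit terms, which stay in `W` by
      -- `hgl`.
      have h := hsub _ (hstable (η j) w hw)
      rw [B.action_apply, Finset.sum_add_distrib] at h
      have h' := (Submodule.add_mem_iff_left W (sum_mem fun i _ => sum_mem fun q _ =>
        W.smul_mem _ (hgl _ w (hsub w hw)))).1 h
      simp only [hcoeff, ite_smul, zero_smul, Finset.sum_ite_eq', Finset.mem_univ, if_true] at h'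
      exact hunit j _ h'
    | zero => simp
    | add x y _ _ hx hy =>
      rw [map_add, map_add, add_add_add_comm]
      exact add_mem hx hy
    | smul r x hx' hx =>
      have : derivOp U t j (r • x) + B.B j (r • x) =
          r • (derivOp U t j x + B.B j x) + partialDeriv t j r • x := by
        rw [derivOp_smul, map_smul, smul_add]
        abel
      rw [this]
      exact add_mem (W.smul_mem r hx) (W.smul_mem _ hx')
  refine eq_top_of_stable (Matrix (Fin s) (Fin s) k) (d := partialDeriv t) (B := B.B)
    (eq_top_of_partialDeriv_stable t) (fun i x w => ?_) ?_ hgl hnabla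
  · exact LinearMap.congr_fun (sub_eq_zero.1 (show (B.B i).restrictScalars k * glOp U C x -
      glOp U C x * (B.B i).restrictScalars k = 0 from B.lie_gl i x)) w
  · obtain ⟨x, hx, hx0⟩ := (Submodule.ne_bot_iff _).1 hN
    exact (Submodule.ne_bot_iff _).2 ⟨x, hsub x hx, hx0⟩

end LocalGauge

/-- Clearing denominators: it turns spanning over `A_(h)` into torsion of a quotient over `A`. -/
theorem exists_smul_mem_of_mem_span {A R X : Type*} [CommRing A] [CommRing R] [Algebra A R]
    [AddCommGroup X] [Module A X] [Module R X] [IsScalarTower A R X] (S : Submonoid A)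
    [IsLocalization S R] (N : Submodule A X) {x : X}
    (hx : x ∈ Submodule.span R (N : Set X)) : ∃ c : S, c.1 • x ∈ N := by
  induction hx using Submodule.span_induction with
  | mem x hx => exact ⟨1, by simpa using hx⟩
  | zero => exact ⟨1, by simp⟩
  | add x y _ _ hx hy =>
    obtain ⟨c, hc⟩ := hx
    obtain ⟨d, hd⟩ := hy
    refine ⟨c * d, ?_⟩
    rw [Submonoid.coe_mul, smul_add]
    refine add_mem ?_ ?_
    · rw [mul_comm, mul_smul]
      exact N.smul_mem _ hc
    · rw [mul_smul]
      exact N.smul_mem _ hd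
  | smul r x _ hx =>
    obtain ⟨c, hc⟩ := hx
    obtain ⟨⟨a, d⟩, had⟩ := IsLocalization.surj S r
    refine ⟨d * c, ?_⟩
    have : (d * c).1 • r • x = a • c.1 • x := by
      rw [← algebraMap_smul R (d * c).1, ← algebraMap_smul R a, ← algebraMap_smul R c.1, ← had,
        Submonoid.coe_mul, map_mul, smul_smul, smul_smul]
      congr 1
      ring
    rw [this]
    exact N.smul_mem a hc

/-- The annihilator of the quotient of an `A𝒱`-module by a submodule is stable under `𝒱`. -/
theorem derivation_mem_annihilator_quotient {k A M : Type*} [Field k] [CommRing A] [Algebra k A]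
    [AddCommGroup M] [Module k M] [Module A M] [LieRingModule (Derivation k A A) M]
    [IsAVModule k A M] {N : Submodule A M} (hN : ∀ (η : Derivation k A A), ∀ x ∈ N, ⁅η, x⁆ ∈ N)
    (η : Derivation k A A) {a : A} (ha : a ∈ Module.annihilator A (M ⧸ N)) :
    η a ∈ Module.annihilator A (M ⧸ N) := by
  have hmem : ∀ b : A, b ∈ Module.annihilator A (M ⧸ N) ↔ ∀ x : M, b • x ∈ N := fun b => by
    rw [Module.mem_annihilator, N.mkQ_surjective.forall]
    simp only [Submodule.mkQ_apply, ← Submodule.Quotient.mk_smul, Submodule.Quotient.mk_eq_zero]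
  rw [hmem] at ha ⊢
  intro x
  have h := hN η _ (ha x)
  rw [IsAVModule.lie_smul_eq (k := k)] at h
  exact (Submodule.add_mem_iff_left _ (ha _)).1 h

end GaugeMod

end

theorem mainTheorem2 {k : Type*} [Field k] [IsAlgClosed k] [CharZero k] {n m s : ℕ}
    (g : Fin m → MvPolynomial (Fin n) k) [(Ideal.span (Set.range g)).IsPrime]
    [Algebra.Smooth k (GaugeMod.CoordRing g)]
    (hdim : ringKrullDim (GaugeMod.CoordRing g) = s)
    (U : Type*) [AddCommGroup U] [Module k U] [FiniteDimensional k U]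
    [LieRingModule (Matrix (Fin s) (Fin s) k) U] [LieModule k (Matrix (Fin s) (Fin s) k) U]
    [LieModule.IsIrreducible k (Matrix (Fin s) (Fin s) k) U]
    (M : Type*) [AddCommGroup M] [Module k M] [Module (GaugeMod.CoordRing g) M]
    [LieRingModule (Derivation k (GaugeMod.CoordRing g) (GaugeMod.CoordRing g)) M]
    [GaugeMod.IsAVModule k (GaugeMod.CoordRing g) M] [Nontrivial M]
    (hM : GaugeMod.IsGaugeModule s g U M) :
    GaugeMod.IsSimpleAVModule k (GaugeMod.CoordRing g) M := by
  refine ⟨inferInstance, fun N hN => or_iff_not_imp_left.2 fun hne => ?_⟩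
  obtain ⟨C⟩ := GaugeMod.nonempty_standardChart g
  obtain ⟨t, B, P, -, e, hfg, he⟩ := hM C
  have : Module.Finite (GaugeMod.CoordRing g) P := Module.Finite.of_fg hfg
  have : Module.Finite (GaugeMod.CoordRing g) M := Module.Finite.equiv e.symm
  let φ : M →ₗ[GaugeMod.CoordRing g] C.LocRing ⊗[k] U := P.subtype ∘ₗ e.toLinearMap
  have hφ : Function.Injective φ := P.injective_subtype.comp e.injective
  have hspan := GaugeMod.span_eq_top_of_action_stable B (N := N.map φ)
    (fun h => hne (Submodule.map_injective_of_injective hφ (h.trans (Submodule.map_bot φ).symm))) (by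
      rintro η _ ⟨x, hx, rfl⟩
      exact ⟨_, hN η x hx, he η x⟩)
  have htors : Module.IsTorsion (GaugeMod.CoordRing g) (M ⧸ N) := fun {y} => by
    obtain ⟨x, rfl⟩ := N.mkQ_surjective y
    obtain ⟨c, hc⟩ := GaugeMod.exists_smul_mem_of_mem_span (Submonoid.powers C.minor) (N.map φ)
      (x := φ x) (hspan ▸ Submodule.mem_top)
    rw [← map_smul, ← SetLike.mem_coe, Submodule.map_coe, hφ.mem_set_image] at hc
    exact ⟨⟨c, C.powers_minor_le c.2⟩, (Submodule.Quotient.mk_eq_zero N).2 hc⟩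
  -- Finite generation is essential here: it yields one nonzero divisor killing all of `M / N`, not
  -- just one for each element.
  obtain ⟨a, ha, ha0⟩ := Submodule.annihilator_top_inter_nonZeroDivisors htors
  rw [Submodule.annihilator_top, SetLike.mem_coe] at ha
  have htop := GaugeMod.eq_top_of_derivation_stable (k := k)
    ((Submodule.ne_bot_iff _).2 ⟨a, ha, nonZeroDivisors.ne_zero ha0⟩)
    fun η b hb => GaugeMod.derivation_mem_annihilator_quotient hN η hb
  exact Submodule.Quotient.subsingleton_iff.1 (Module.annihilator_eq_top_iff.1 htop)
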